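/- Theorem 5. A RAM has registers $R_0,R_1,R_2,\dots$ holding non-negative integers, and its program is a finite list of labelled commands: assignments (a basic operation is applied to operands, each of which is the constant $0$, the constant $1$ or an explicitly named register, and the result is stored in a named register), jumps conditional on the equality of two operands, unconditional jumps, and halt. Execution starts at the first command, every executed command costs one unit of time, and there is no indirect addressing. Let the basic operations be addition $a+b$; exact division $a/b$, which is defined only if $b\neq 0$ and $b$ divides $a$; left shift $a\leftarrow b = a\cdot 2^b$; and all bitwise Boolean functions, applied to the bit positions up to and including the most significant $1$ bit among all operands (so $\lnot a$ negates the bits of $a$ up to and including its most significant $1$ bit). Then for every recursively enumerable set $S\subseteq\mathbb{N}=\{0,1,2,\dots\}$ there are a Boolean function $g:\mathbb{N}\times\mathbb{N}\to\{0,1\}$, a program over these operations and a constant $C$ such that the following hold. 1. For all $\mathit{inp},x\in\mathbb{N}$, the program, started with $R_0=\mathit{inp}$, $R_1=x$ and all other registers $0$, halts after at most $C$ commands with $R_0=g(\mathit{inp},x)$, and never applies a division that is undefined. 2. If $\mathit{inp}\in S$, then $g(\mathit{inp},x)=1$ for all but finitely many $x$. 3. If $\mathit{inp}\notin S$, then $g(\mathit{inp},x)=0$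 for all but finitely many $x$. That is, $S$ is recognized in $O(1)$ time by an ARAM (a RAM assisted by an arbitrary large number $x$) with the operations $+$, $/$, $\leftarrow$ and the bitwise Boolean functions. -/

import Mathlib

namespace ARAM

/-- A basic operation of a RAM on non-negative integers: its arity `k` and its value on `k` operands,
`none` meaning that the operation is undefined on these operands. -/
structure Operation where
  arity : ℕ
  eval : (Fin arity → ℕ) → Option ℕ

/-- Addition `a + b`. -/
def opAdd : Operation where
  arity := 2
  eval v := some (v 0 + v 1)

/-- Exact division `a / b`, defined only when `b ≠ 0` divides `a`. -/
def opExactDiv : Operation where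
  arity := 2
  eval v := if v 1 ≠ 0 ∧ v 1 ∣ v 0 then some (v 0 / v 1) else none

/-- Left shift, `a * 2 ^ b`. -/
def opShiftLeft : Operation where
  arity := 2
  eval v := some (v 0 * 2 ^ v 1)

/-- The bitwise operation of a `k`-ary Boolean function `f`. It acts on the bit positions up to and
including the most significant `1` bit among all operands; all higher bits of the result are `0`.
For `f` with `f (0, …, 0) = 0` this is the plain bitwise operation; for `k = 1` and `f` the
negation it negates the bits of `a` up to and including its most significant `1` bit. -/
def opBitwise (k : ℕ) (f : (Fin k → Bool) → Bool) : Operation where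
  arity := k
  eval v := some (Nat.ofBits fun i : Fin (Finset.univ.sup fun j => (v j).size) =>
    f fun j => (v j).testBit i)

/-- The operation set consisting of addition, exact division, left shift and all bitwise Boolean
functions. -/
def addDivShiftBool : Set Operation :=
  {opAdd, opExactDiv, opShiftLeft} ∪
    {o | ∃ (k : ℕ) (f : (Fin k → Bool) → Bool), o = opBitwise k f}

/-- Operands: the explicit constants `0` and `1`, and explicitly named registers
(there is no indirect addressing). -/
inductive Operand where
  | zero : Operand
  | one : Operand
  | reg : ℕ → Operand

/-- The value of an operand, given the register contents. -/
def Operand.val (R : ℕ → ℕ) : Operand → ℕ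
  | .zero => 0
  | .one => 1
  | .reg i => R i

/-- The commands of a RAM with the operation set `ops`. Labels are natural numbers; equality is the
only comparison operator. -/
inductive Command (ops : Set Operation) where
  | assign (o : Operation) (ho : o ∈ ops) (args : Fin o.arity → Operand) (target : ℕ) : Command ops
  | ifEq (a b : Operand) (labelTrue labelFalse : ℕ) : Command ops
  | jump (label : ℕ) : Command ops
  | halt : Command ops

/-- A RAM program: a finite list of commands, the label of a command being its position in the
list (the first command has label `0`). -/
abbrev Program (ops : Set Operation) := List (Command ops)

/-- `run P t l R` is the output (the content of register `0` at the halt command) of the program `P`,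
started at label `l` with register contents `R`, provided that it executes a halt command
as one of its first `t` commands. Otherwise it is `none`; in particular applying an operation where
it is undefined, or reaching a label that does not exist, gives no output. -/
def run {ops : Set Operation} (P : Program ops) : ℕ → ℕ → (ℕ → ℕ) → Option ℕ
  | 0, _, _ => none
  | t + 1, l, R =>
    match P[l]? with
    | none => none
    | some .halt => some (R 0)
    | some (.jump l') => run P t l' R
    | some (.ifEq a b l₁ l₂) => run P t (if a.val R = b.val R then l₁ else l₂) R
    | some (.assign o _ args target) =>
      (o.eval fun i => (args i).val R).bind fun y => run P t (l + 1) (Function.update R target y)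

/-- Initial registers of a RAM with two inputs: these are in the first two registers, and all
other registers are `0`. -/
def initRegs (inp x : ℕ) : ℕ → ℕ
  | 0 => inp
  | 1 => x
  | _ => 0

/-- The Boolean function `g` of two arguments is computable in time `T (n)` by a RAM with the
operation set `ops`, where `n` is the bit length of the first argument. -/
def RAMComputable (ops : Set Operation) (T : ℕ → ℕ) (g : ℕ → ℕ → Bool) : Prop :=
  ∃ P : Program ops, ∀ inp x : ℕ,
    run P (T inp.size) 0 (initRegs inp x) = some (g inp x).toNat

/-- The set `S` is computable in time `T (n)` by an ARAM with the operation set `ops`, that is by a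
RAM which is assisted by an arbitrary large number `x`. -/
def ARAMComputable (ops : Set Operation) (T : ℕ → ℕ) (S : Set ℕ) : Prop :=
  ∃ g : ℕ → ℕ → Bool, RAMComputable ops T g ∧
    ∀ inp : ℕ, (inp ∈ S → ∀ᶠ x in Filter.cofinite, g inp x = true) ∧
      (inp ∉ S → ∀ᶠ x in Filter.cofinite, g inp x = false)

end ARAM

/-!
The program decides, in a constant number of word operations, whether the input is accepted within
a time bound that grows with `x`; as `x` tends to infinity this settles membership in `S`.

Mathlib simulates partial recursive functions by `TM2` machines, which work on finitely many stacks.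
Carried out instruction by instruction, such a machine is a `StackMachine` with finitely many
states, in which each step changes every stack by at most one symbol (`exists_stackMachine`). With
the stacks written from the top, the entry `j` of a stack depends only on the entries `j - 1`, `j`,
`j + 1` one step earlier, so a run is a two-dimensional array subject to a local rule
(`StackMachine.IsDiagram`). The input belongs to `S` iff such an array with `c` rows and columns
exists for all large `c` (`IsDiagram.halts`, `exists_isDiagram`), and otherwise none exists for any
`c > 0`.

With `c = 2 ^ x` and `W` a sufficiently large power of two, every array is coded by a number below
`N = 2 ^ W`. All these numbers can be listed in one: if `A = (N ^ N - 1) / (N - 1) = ∑ N ^ i`, then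
`(A - N) / (N - 1)` has the digits `N - 1, …, 1, 0` in base `N` (`Computed.enumeration`), and both
divisions are exact. The same quotients copy a number into all fields (`Computed.replicate`).
Copies of the enumeration, shifted by the distances between neighbouring cells and between the bits
of a cell, are fed into one bitwise Boolean function, which marks all violations of the local rule
in all arrays. Some array is free of violations iff some field of the result is `0`, which an
addition detects by its carries (`add_land_eq_iff`, `exists_computed_search`).

No jumps are needed before the final comparison. Functions computed by straight-line code are closed
under composition with the basic operations (`StraightLine.op`), and all divisions that occur are
exact for all inputs, however small `x` is.
-/

namespace ARAM

/-! ### Straight-line programs -/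

/-- An assignment command of a RAM, as data. -/
structure Assignment (ops : Set Operation) where
  op : Operation
  mem : op ∈ ops
  args : Fin op.arity → Operand
  target : ℕ

variable {ops : Set Operation}

/-- The RAM command that carries out an assignment. -/
def Assignment.toCommand (s : Assignment ops) : Command ops :=
  .assign s.op s.mem s.args s.target

/-- The register contents after a list of assignments; `none` if some operation is undefined. -/
def exec : List (Assignment ops) → (ℕ → ℕ) → Option (ℕ → ℕ)
  | [], R => some R
  | s :: l, R =>
    (s.op.eval fun i => (s.args i).val R).bind fun y => exec l (Function.update R s.target y)

theorem exec_append (l₁ l₂ : List (Assignment ops)) (R : ℕ → ℕ) :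
    exec (l₁ ++ l₂) R = (exec l₁ R).bind (exec l₂) := by
  induction l₁ generalizing R with
  | nil => rfl
  | cons s l ih =>
    simp only [List.cons_append, exec, Option.bind_assoc]
    congr 1
    funext y
    exact ih _

theorem run_straightLine (pre : Program ops) (code : List (Assignment ops)) (suf : Program ops)
    (t : ℕ) (R : ℕ → ℕ) :
    run (pre ++ code.map Assignment.toCommand ++ suf) (code.length + t) pre.length R =
      (exec code R).bind fun R' =>
        run (pre ++ code.map Assignment.toCommand ++ suf) t (pre.length + code.length) R' := by
  induction code generalizing pre R with
  | nil => simp [exec]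
  | cons s l ih =>
    have hget : (pre ++ (s :: l).map Assignment.toCommand ++ suf)[pre.length]? =
        some s.toCommand := by simp
    rw [List.length_cons, show l.length + 1 + t = (l.length + t) + 1 by ring, run, hget]
    simp only [Assignment.toCommand, exec, Option.bind_assoc]
    congr 1
    funext y
    have := ih (pre ++ [s.toCommand]) (Function.update R s.target y)
    simp only [List.length_append, List.length_singleton, List.append_assoc,
      List.cons_append, List.nil_append] at this
    simp only [List.map_cons, List.append_assoc, List.cons_append]
    simp only [Assignment.toCommand] at this ⊢
    rw [this]
    congr 1
    funext R'
    congr 1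
    ring

/-- The operand depends only on registers with an index below `m`. -/
def Operand.Below (m : ℕ) (a : Operand) : Prop :=
  ∀ R R' : ℕ → ℕ, (∀ i < m, R' i = R i) → a.val R' = a.val R

theorem Operand.Below.mono {m m' : ℕ} {a : Operand} (h : a.Below m) (hm : m ≤ m') : a.Below m' :=
  fun R R' hR => h R R' fun i hi => hR i (hi.trans_le hm)

theorem Operand.below_reg {m i : ℕ} (h : i < m) : (Operand.reg i).Below m :=
  fun _ _ hR => hR i h

/-- The function `F` of the contents of the registers `0` and `1` is computed by straight-line
code. For every `n ≥ 2` the code can be chosen such that it leaves the registers below `n` alone,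
which is what makes such codes composable; the value is then the value of an operand `a` that only
depends on the registers below a new bound `m`. -/
def StraightLine (ops : Set Operation) (F : ℕ → ℕ → ℕ) : Prop :=
  ∀ n ≥ 2, ∃ (code : List (Assignment ops)) (m : ℕ) (a : Operand), n ≤ m ∧ a.Below m ∧
    ∀ R : ℕ → ℕ, ∃ R', exec code R = some R' ∧ (∀ i < n, R' i = R i) ∧ a.val R' = F (R 0) (R 1)

theorem StraightLine.of_operand {F : ℕ → ℕ → ℕ} (a : Operand) (ha : a.Below 2)
    (h : ∀ R : ℕ → ℕ, a.val R = F (R 0) (R 1)) : StraightLine ops F :=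
  fun n hn => ⟨[], n, a, le_rfl, ha.mono hn, fun R => ⟨R, rfl, fun _ _ => rfl, h R⟩⟩

theorem StraightLine.fst : StraightLine ops fun inp _ => inp :=
  .of_operand (.reg 0) (Operand.below_reg (by norm_num)) fun _ => rfl

theorem StraightLine.snd : StraightLine ops fun _ x => x :=
  .of_operand (.reg 1) (Operand.below_reg (by norm_num)) fun _ => rfl

theorem StraightLine.zero : StraightLine ops fun _ _ => 0 :=
  .of_operand .zero (fun _ _ _ => rfl) fun _ => rfl

theorem StraightLine.one : StraightLine ops fun _ _ => 1 :=
  .of_operand .one (fun _ _ _ => rfl) fun _ => rfl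

/-- Finitely many functions can be computed one after the other, as each code preserves the
registers that hold the values found before. -/
theorem StraightLine.pi {k : ℕ} {F : Fin k → ℕ → ℕ → ℕ} (hF : ∀ i, StraightLine ops (F i)) :
    ∀ n ≥ 2, ∃ (code : List (Assignment ops)) (m : ℕ) (a : Fin k → Operand), n ≤ m ∧
      (∀ i, (a i).Below m) ∧ ∀ R : ℕ → ℕ, ∃ R', exec code R = some R' ∧
        (∀ i < n, R' i = R i) ∧ ∀ i, (a i).val R' = F i (R 0) (R 1) := by
  induction k with
  | zero => exact fun n _ => ⟨[], n, Fin.elim0, le_rfl, fun i => i.elim0,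
      fun R => ⟨R, rfl, fun _ _ => rfl, fun i => i.elim0⟩⟩
  | succ k ih =>
    intro n hn
    obtain ⟨code₁, m₁, a₁, hm₁, ha₁, h₁⟩ := hF 0 n hn
    obtain ⟨code₂, m₂, a₂, hm₂, ha₂, h₂⟩ := ih (fun i => hF i.succ) m₁ (hn.trans hm₁)
    refine ⟨code₁ ++ code₂, m₂, Fin.cons a₁ a₂, hm₁.trans hm₂,
      Fin.cases (ha₁.mono hm₂) ha₂, fun R => ?_⟩
    obtain ⟨R₁, e₁, f₁, v₁⟩ := h₁ R
    obtain ⟨R₂, e₂, f₂, v₂⟩ := h₂ R₁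
    refine ⟨R₂, by rw [exec_append, e₁, Option.bind_some, e₂],
      fun i hi => (f₂ i (hi.trans_le hm₁)).trans (f₁ i hi), Fin.cases ?_ fun i => ?_⟩
    · rw [Fin.cons_zero, ha₁ R₁ R₂ f₂, v₁]
    · rw [Fin.cons_succ, v₂, f₁ 0 (by omega), f₁ 1 (by omega)]

/-- The closure of straight-line computability under a basic operation that is defined at all
values that occur. -/
theorem StraightLine.op {o : Operation} (ho : o ∈ ops) {F : Fin o.arity → ℕ → ℕ → ℕ}
    (hF : ∀ i, StraightLine ops (F i)) {G : ℕ → ℕ → ℕ}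
    (hG : ∀ inp x, o.eval (fun i => F i inp x) = some (G inp x)) : StraightLine ops G := by
  intro n hn
  obtain ⟨code, m, a, hm, -, h⟩ := StraightLine.pi hF n hn
  refine ⟨code ++ [⟨o, ho, a, m⟩], m + 1, .reg m, by omega,
    Operand.below_reg (by omega), fun R => ?_⟩
  obtain ⟨R', e, f, v⟩ := h R
  refine ⟨Function.update R' m (G (R 0) (R 1)), ?_, fun i hi => ?_, ?_⟩
  · simp [exec_append, e, exec, v, hG]
  · rw [Function.update_of_ne (by omega), f i hi]
  · simp [Operand.val]

/-- Comparing the values of two straight-line codes takes a constant number of commands. -/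
theorem StraightLine.ramComputable {F G : ℕ → ℕ → ℕ} (hadd : opAdd ∈ ops)
    (hF : StraightLine ops F) (hG : StraightLine ops G) :
    ∃ C : ℕ, RAMComputable ops (fun _ => C) fun inp x => decide (F inp x ≠ G inp x) := by
  obtain ⟨code, m, a, -, -, h⟩ := StraightLine.pi (F := ![F, G])
    (Fin.cases hF (Fin.cases hG fun i => i.elim0)) 2 le_rfl
  let l := code.length
  let suf : Program ops := [.ifEq (a 0) (a 1) (l + 1) (l + 3),
    .assign opAdd hadd (fun _ => .zero) 0, .halt,
    .assign opAdd hadd ![.zero, .one] 0, .halt]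
  refine ⟨l + 3, code.map Assignment.toCommand ++ suf, fun inp x => ?_⟩
  obtain ⟨R', e, -, v⟩ := h (initRegs inp x)
  obtain ⟨P, hP⟩ : ∃ P, P = code.map Assignment.toCommand ++ suf := ⟨_, rfl⟩
  have hrun := run_straightLine [] code suf 3 (initRegs inp x)
  simp only [List.nil_append, List.length_nil, zero_add, e, Option.bind_some, ← hP] at hrun
  have hget (i : ℕ) : P[l + i]? = suf[i]? := by
    rw [hP, List.getElem?_append_right (by simp [l])]
    simp [l]
  have g0 : P[l]? = some (.ifEq (a 0) (a 1) (l + 1) (l + 3)) := hget 0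
  have g1 : P[l + 1]? = some (.assign opAdd hadd (fun _ => .zero) 0) := hget 1
  have g2 : P[l + 1 + 1]? = some .halt := hget 2
  have g3 : P[l + 3]? = some (.assign opAdd hadd ![.zero, .one] 0) := hget 3
  have g4 : P[l + 3 + 1]? = some .halt := hget 4
  have h0 : (a 0).val R' = F inp x := v 0
  have h1 : (a 1).val R' = G inp x := v 1
  rw [← hP]
  refine hrun.trans ?_
  by_cases hFG : F inp x = G inp x
  · simp only [run, l, g0, g1, g2, h0, h1, hFG, if_true]
    simp [opAdd, Operand.val]
  · simp only [run, l, g0, g3, g4, h0, h1, hFG, if_false]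
    simp [opAdd, Operand.val, hFG]

/-! ### Straight-line arithmetic with addition, division, shifts and Boolean functions -/

theorem opAdd_mem : opAdd ∈ addDivShiftBool := by simp [addDivShiftBool]

theorem opBitwise_mem (k : ℕ) (f : (Fin k → Bool) → Bool) : opBitwise k f ∈ addDivShiftBool :=
  Or.inr ⟨k, f, rfl⟩

/-- `StraightLine` for the operations `+`, `/`, `←` and the bitwise Boolean functions. -/
abbrev Computed (F : ℕ → ℕ → ℕ) : Prop := StraightLine addDivShiftBool F

namespace Computed

variable {F G : ℕ → ℕ → ℕ}

theorem fst : Computed fun inp _ => inp := StraightLine.fst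

theorem snd : Computed fun _ x => x := StraightLine.snd

theorem one : Computed fun _ _ => 1 := StraightLine.one

theorem add (hF : Computed F) (hG : Computed G) : Computed fun inp x => F inp x + G inp x :=
  StraightLine.op (o := opAdd) opAdd_mem (F := ![F, G])
    (Fin.cases hF (Fin.cases hG fun i => i.elim0)) fun _ _ => rfl

theorem div (hF : Computed F) (hG : Computed G) (h0 : ∀ inp x, G inp x ≠ 0)
    (hd : ∀ inp x, G inp x ∣ F inp x) : Computed fun inp x => F inp x / G inp x :=
  StraightLine.op (o := opExactDiv) (by simp [addDivShiftBool]) (F := ![F, G])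
    (Fin.cases hF (Fin.cases hG fun i => i.elim0)) fun inp x => if_pos ⟨h0 inp x, hd inp x⟩

theorem shiftLeft (hF : Computed F) (hG : Computed G) :
    Computed fun inp x => F inp x * 2 ^ G inp x :=
  StraightLine.op (o := opShiftLeft) (by simp [addDivShiftBool]) (F := ![F, G])
    (Fin.cases hF (Fin.cases hG fun i => i.elim0)) fun _ _ => rfl

theorem const (k : ℕ) : Computed fun _ _ => k := by
  induction k with
  | zero => exact StraightLine.zero
  | succ k ih => exact ih.add one

theorem two_pow (hF : Computed F) : Computed fun inp x => 2 ^ F inp x := by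
  simpa using shiftLeft one hF

theorem const_mul (k : ℕ) (hF : Computed F) : Computed fun inp x => k * F inp x := by
  induction k with
  | zero => simpa using const 0
  | succ k ih => simpa [Nat.succ_mul] using ih.add hF

/-- For a Boolean function with value `0` at `(0, …, 0)` the restriction to the bit positions up
to the most significant `1` bit of the operands is immaterial. -/
theorem exists_bitwise {ι : Type*} [Fintype ι] {F : ι → ℕ → ℕ → ℕ} (hF : ∀ i, Computed (F i))
    (f : (ι → Bool) → Bool) (hf : f (fun _ => false) = false) :
    ∃ G, Computed G ∧
      ∀ inp x n, (G inp x).testBit n = f fun i => (F i inp x).testBit n := by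
  let e := Fintype.equivFin ι
  refine ⟨_, StraightLine.op (opBitwise_mem (Fintype.card ι) fun v => f (v ∘ e))
    (F := fun i => F (e.symm i)) (fun i => hF _) fun inp x => rfl, fun inp x n => ?_⟩
  rw [Nat.testBit_ofBits]
  split_ifs with h
  · simp [Function.comp_def]
  · rw [← hf]
    congr 1
    funext i
    symm
    apply Nat.testBit_lt_two_pow
    rw [← Nat.size_le]
    refine le_trans ?_ (not_lt.1 h)
    simpa using Finset.le_sup (f := fun j => (F (e.symm j) inp x).size) (Finset.mem_univ (e i))

theorem land (hF : Computed F) (hG : Computed G) :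
    Computed fun inp x => F inp x &&& G inp x := by
  obtain ⟨E, hE, h⟩ := exists_bitwise (F := fun b : Bool => if b then F else G)
    (fun b => by cases b <;> simpa) (fun v => v true && v false) rfl
  convert hE using 3 with inp x
  exact Nat.eq_of_testBit_eq fun n => by simp [h]

/-- Flipping all bits of `a` up to the most significant one gives `2 ^ a.size - 1 - a`. -/
theorem complement (hF : Computed F) :
    Computed fun inp x => 2 ^ (F inp x).size - (F inp x + 1) := by
  refine StraightLine.op (opBitwise_mem 1 fun v => !v 0) (F := fun _ => F) (fun _ => hF)
    fun inp x => congrArg some (Nat.eq_of_testBit_eq fun n => ?_)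
  rw [Nat.testBit_ofBits, Nat.testBit_two_pow_sub_succ (Nat.lt_size_self _)]
  simp [Finset.sup_const]

/-- With `s` the bit length of `a`, the complement of `a` plus `b` is `2 ^ s - 1 - (a - b)`, whose
complement in `s` bits is `a - b`. The second complement takes `a` as an additional operand,
which fixes the number of bits to `s`. -/
theorem sub (hF : Computed F) (hG : Computed G) (h : ∀ inp x, G inp x ≤ F inp x) :
    Computed fun inp x => F inp x - G inp x := by
  refine StraightLine.op (opBitwise_mem 2 fun v => !v 1)
    (F := ![F, fun inp x => 2 ^ (F inp x).size - (F inp x + 1) + G inp x])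
    (Fin.cases hF (Fin.cases (hF.complement.add hG) fun i => i.elim0))
    fun inp x => congrArg some (Nat.eq_of_testBit_eq fun n => ?_)
  have hlt := Nat.lt_size_self (F inp x)
  have hle := h inp x
  set a := F inp x
  set b := G inp x
  have hy : 2 ^ a.size - (a + 1) + b < 2 ^ a.size := by omega
  have hsize : (Finset.univ.sup fun j : Fin 2 =>
      ((![F, fun inp x => 2 ^ (F inp x).size - (F inp x + 1) + G inp x] : Fin 2 → ℕ → ℕ → ℕ) j
        inp x).size) = a.size := by
    rw [Fin.univ_succ]
    refine Eq.trans ?_ (max_eq_left (Nat.size_le.2 hy))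
    simp [a, b]
  rw [Nat.testBit_ofBits]
  have key : a - b = 2 ^ a.size - ((2 ^ a.size - (a + 1) + b) + 1) := by omega
  rw [key, Nat.testBit_two_pow_sub_succ hy]
  have hcond : n < (Finset.univ.sup fun j : Fin 2 =>
      ((![F, fun inp x => 2 ^ (F inp x).size - (F inp x + 1) + G inp x] : Fin 2 → ℕ → ℕ → ℕ) j
        inp x).size) ↔ n < a.size := by rw [hsize]
  by_cases hn : n < a.size
  · rw [dif_pos (hcond.2 hn)]
    simp [hn, a, b]
  · rw [dif_neg (hcond.not.2 hn)]
    simp [hn]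

/-- The bitwise function that is constantly `1` turns `a` into `2 ^ a.size - 1`. -/
theorem two_pow_size (hF : Computed F) : Computed fun inp x => 2 ^ (F inp x).size := by
  have : Computed fun inp x => 2 ^ (F inp x).size - 1 := by
    refine StraightLine.op (opBitwise_mem 1 fun _ => true) (F := fun _ => F) (fun _ => hF)
      fun inp x => congrArg some (Nat.eq_of_testBit_eq fun n => ?_)
    rw [Nat.testBit_ofBits, Nat.testBit_two_pow_sub_one]
    simp [Finset.sup_const]
  simpa [Nat.sub_add_cancel Nat.one_le_two_pow] using this.add one

end Computed

/-! ### Stack machines -/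

/-- What a step of a stack machine does to one of its stacks. -/
inductive StackAction (Γ : Type*) where
  | keep : StackAction Γ
  | pop : StackAction Γ
  | push (a : Γ) : StackAction Γ

/-- The effect of an action on a stack, the top of the stack being the head of the list. -/
def StackAction.apply {Γ : Type*} : StackAction Γ → List Γ → List Γ
  | .keep, s => s
  | .pop, s => s.tail
  | .push a, s => a :: s

/-- A deterministic machine with stacks indexed by `K`. In a step with state `q` it applies the
action `act q k` to each stack `k`, and `next` gives the new state in terms of `q` and the tops of
the stacks; only the new state may depend on the tops. The state `halt` is absorbing. -/
structure StackMachine (Q K Γ : Type*) where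
  act : Q → K → StackAction Γ
  next : Q → (K → Option Γ) → Q
  halt : Q
  act_halt : ∀ k, act halt k = .keep
  next_halt : ∀ t, next halt t = halt

namespace StackMachine

variable {Q K Γ : Type*} (M : StackMachine Q K Γ)

/-- One step of a stack machine. A configuration consists of the state and the stacks. -/
def step (c : Q × (K → List Γ)) : Q × (K → List Γ) :=
  (M.next c.1 fun k => (c.2 k).head?, fun k => (M.act c.1 k).apply (c.2 k))

/-- The machine reaches its halting state from the configuration `c`. -/
def Halts (c : Q × (K → List Γ)) : Prop :=
  ∃ n, (M.step^[n] c).1 = M.halt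

theorem step_eq_self {c : Q × (K → List Γ)} (h : c.1 = M.halt) : M.step c = c := by
  obtain ⟨q, s⟩ := c
  obtain rfl : q = M.halt := h
  simp [step, M.next_halt, M.act_halt, StackAction.apply]

theorem iterate_step_eq {c : Q × (K → List Γ)} {m n : ℕ} (h : (M.step^[m] c).1 = M.halt)
    (hmn : m ≤ n) : M.step^[n] c = M.step^[m] c := by
  obtain ⟨d, rfl⟩ := Nat.exists_eq_add_of_le hmn
  rw [add_comm, Function.iterate_add_apply]
  exact Function.iterate_fixed (M.step_eq_self h) d

theorem length_iterate_step_le (c : Q × (K → List Γ)) (k : K) (n : ℕ) :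
    ((M.step^[n] c).2 k).length ≤ (c.2 k).length + n := by
  induction n with
  | zero => simp
  | succ n ih =>
    rw [Function.iterate_succ_apply']
    have : ((M.step (M.step^[n] c)).2 k).length ≤ ((M.step^[n] c).2 k).length + 1 := by
      simp only [step]
      cases M.act (M.step^[n] c).1 k <;> simp [StackAction.apply]
      omega
    omega

/-- A machine restricted to a set of states that is closed under its transitions. -/
def restrict (T : Set Q) (hT : ∀ q ∈ T, ∀ t, M.next q t ∈ T) (h : M.halt ∈ T) :
    StackMachine T K Γ where
  act q := M.act q
  next q t := ⟨M.next q t, hT q q.2 t⟩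
  halt := ⟨M.halt, h⟩
  act_halt := M.act_halt
  next_halt t := Subtype.ext (M.next_halt t)

theorem restrict_halts_iff {T : Set Q} (hT : ∀ q ∈ T, ∀ t, M.next q t ∈ T) (h : M.halt ∈ T)
    (q : T) (s : K → List Γ) : (M.restrict T hT h).Halts (q, s) ↔ M.Halts (q, s) := by
  have key (n : ℕ) : M.step^[n] ((q : Q), s) =
      Prod.map Subtype.val id ((M.restrict T hT h).step^[n] (q, s)) := by
    induction n with
    | zero => rfl
    | succ n ih => rw [Function.iterate_succ_apply', Function.iterate_succ_apply', ih]; rfl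
  simp only [Halts, key]
  exact exists_congr fun n => Subtype.ext_iff

end StackMachine

/-! ### From Mathlib's `TM2` machines to stack machines -/

section TM2

open Turing

variable {K Γ Λ σ : Type*}

/-- The first instruction of a `TM2` statement as an action on the stacks. -/
def stmtAct [DecidableEq K] : TM2.Stmt (fun _ : K => Γ) Λ σ → σ → K → StackAction Γ
  | .push k f _, v => Function.update (fun _ => .keep) k (.push (f v))
  | .pop k _ _, _ => Function.update (fun _ => .keep) k .pop
  | _, _ => fun _ => .keep

/-- The statement and the internal state after the first instruction of a `TM2` statement, given
the tops of the stacks; `none` after the instruction `halt`. -/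
def stmtNext (M : Λ → TM2.Stmt (fun _ : K => Γ) Λ σ) :
    TM2.Stmt (fun _ : K => Γ) Λ σ → σ → (K → Option Γ) →
      Option (TM2.Stmt (fun _ : K => Γ) Λ σ × σ)
  | .push _ _ q, v, _ => some (q, v)
  | .peek k f q, v, t => some (q, f v (t k))
  | .pop k f q, v, t => some (q, f v (t k))
  | .load f q, v, _ => some (q, f v)
  | .branch f q₁ q₂, v, _ => some (bif f v then q₁ else q₂, v)
  | .goto f, v, _ => some (M (f v), v)
  | .halt, _, _ => none

/-- The stack machine that carries out a `TM2` machine instruction by instruction. -/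
def ofTM2 [DecidableEq K] (M : Λ → TM2.Stmt (fun _ : K => Γ) Λ σ) :
    StackMachine (Option (TM2.Stmt (fun _ : K => Γ) Λ σ × σ)) K Γ where
  act q := q.elim (fun _ => .keep) fun p => stmtAct p.1 p.2
  next q t := q.elim none fun p => stmtNext M p.1 p.2 t
  halt := none
  act_halt _ := rfl
  next_halt _ := rfl

/-- The configuration of `ofTM2 M` that represents a configuration of `M`. -/
def ofCfg (M : Λ → TM2.Stmt (fun _ : K => Γ) Λ σ) (c : TM2.Cfg (fun _ : K => Γ) Λ σ) :
    Option (TM2.Stmt (fun _ : K => Γ) Λ σ × σ) × (K → List Γ) :=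
  (c.l.map fun l => (M l, c.var), c.stk)

variable (M : Λ → TM2.Stmt (fun _ : K => Γ) Λ σ)

theorem stmtNext_mem_stmts [Inhabited Λ] {S : Finset Λ} (hS : TM2.Supports M S)
    {q q' : TM2.Stmt (fun _ : K => Γ) Λ σ} {v v' : σ} {t : K → Option Γ}
    (hq : some q ∈ TM2.stmts M S) (h : stmtNext M q v t = some (q', v')) :
    some q' ∈ TM2.stmts M S := by
  have hsup := TM2.stmts_supportsStmt hS hq
  have self (q : TM2.Stmt (fun _ : K => Γ) Λ σ) := TM2.stmts₁_self (q := q)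
  cases q with
  | goto f =>
    simp only [stmtNext, Option.some.injEq, Prod.mk.injEq] at h
    simp only [TM2.stmts, Finset.some_mem_insertNone, Finset.mem_biUnion]
    exact ⟨f v, hsup v, h.1 ▸ self _⟩
  | halt => simp [stmtNext] at h
  | branch f q₁ q₂ =>
    refine TM2.stmts_trans ?_ hq
    simp only [stmtNext, Option.some.injEq, Prod.mk.injEq] at h
    rw [← h.1]
    cases f v <;> simp [TM2.stmts₁, self]
  | _ =>
    refine TM2.stmts_trans ?_ hq
    simp only [stmtNext, Option.some.injEq, Prod.mk.injEq] at h
    simp [TM2.stmts₁, ← h.1, self]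

variable [DecidableEq K]

theorem apply_update_keep (k : K) (a : StackAction Γ) (S : K → List Γ) :
    (fun k' => (Function.update (fun _ => StackAction.keep) k a k').apply (S k')) =
      Function.update S k (a.apply (S k)) := by
  funext k'
  by_cases h : k' = k
  · subst h; simp
  · simp [h, StackAction.apply]

/-- A `TM2` step, which executes a whole statement, takes one or more steps of `ofTM2 M`. -/
theorem exists_iterate_ofTM2_stepAux (q : TM2.Stmt (fun _ : K => Γ) Λ σ) (v : σ)
    (S : K → List Γ) :
    ∃ n ≥ 1, (ofTM2 M).step^[n] (some (q, v), S) = ofCfg M (TM2.stepAux q v S) := by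
  have more {c d : Option (TM2.Stmt (fun _ : K => Γ) Λ σ × σ) × (K → List Γ)}
      (h : ∃ n ≥ 1, (ofTM2 M).step^[n] ((ofTM2 M).step c) = d) :
      ∃ n ≥ 1, (ofTM2 M).step^[n] c = d :=
    let ⟨n, _, e⟩ := h
    ⟨n + 1, by omega, e⟩
  induction q generalizing v S with
  | push k f q ih =>
    have e : (ofTM2 M).step (some (.push k f q, v), S) =
        (some (q, v), Function.update S k (f v :: S k)) :=
      Prod.ext rfl (apply_update_keep k (.push (f v)) S)
    exact more (e ▸ ih _ _)
  | peek k f q ih =>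
    exact more (ih (f v (S k).head?) S)
  | pop k f q ih =>
    have e : (ofTM2 M).step (some (.pop k f q, v), S) =
        (some (q, f v (S k).head?), Function.update S k (S k).tail) :=
      Prod.ext rfl (apply_update_keep k .pop S)
    exact more (e ▸ ih _ _)
  | load f q ih =>
    exact more (ih (f v) S)
  | branch f q₁ q₂ ih₁ ih₂ =>
    have e : (ofTM2 M).step (some (.branch f q₁ q₂, v), S) =
        (some (bif f v then q₁ else q₂, v), S) := rfl
    refine more ?_
    rw [e, TM2.stepAux]
    cases f v
    exacts [ih₂ v S, ih₁ v S]
  | goto f => exact ⟨1, le_rfl, rfl⟩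
  | halt => exact ⟨1, le_rfl, rfl⟩

theorem ofTM2_halts_iff (c : TM2.Cfg (fun _ : K => Γ) Λ σ) :
    (ofTM2 M).Halts (ofCfg M c) ↔ (StateTransition.eval (TM2.step M) c).Dom := by
  constructor
  · rintro ⟨n, hn⟩
    induction n using Nat.strong_induction_on generalizing c with
    | _ n ih =>
      obtain ⟨l | l, v, S⟩ := c
      · exact Part.dom_iff_mem.2 ⟨_, StateTransition.mem_eval.2 ⟨.refl, rfl⟩⟩
      · obtain ⟨m, hm, e⟩ := exists_iterate_ofTM2_stepAux M (M l) v S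
        have hn0 : n ≠ 0 := by
          rintro rfl
          simp [ofCfg, ofTM2] at hn
        rw [StateTransition.reaches_eval
          (.single (by rfl : TM2.stepAux (M l) v S ∈ TM2.step M ⟨some l, v, S⟩))]
        refine ih (n - m) (by omega) _ ?_
        rw [← e, ← Function.iterate_add_apply]
        have := (ofTM2 M).iterate_step_eq (n := n - m + m) hn (by omega)
        rw [← hn, ← this]
        rfl
  · intro h
    obtain ⟨b, hb⟩ := Part.dom_iff_mem.1 h
    obtain ⟨hr, hb⟩ := StateTransition.mem_eval.1 hb
    obtain ⟨l | l, v, S⟩ := b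
    · refine Relation.ReflTransGen.head_induction_on hr ⟨0, rfl⟩ ?_
      rintro ⟨l | l, v', S'⟩ d hd - ⟨n, hn⟩
      · simp at hd
      · obtain ⟨m, -, e⟩ := exists_iterate_ofTM2_stepAux M (M l) v' S'
        obtain rfl : TM2.stepAux (M l) v' S' = d := by simpa using hd
        rw [← e, ← Function.iterate_add_apply] at hn
        exact ⟨n + m, hn⟩
    · simp at hb

/-- A `TM2` machine with finitely many accessible labels and finitely many internal states is
simulated by a stack machine with finitely many states. -/
theorem exists_stackMachine_of_supports [Inhabited Λ] [Finite σ] {S : Finset Λ}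
    (hS : TM2.Supports M S) {l₀ : Λ} (hl₀ : l₀ ∈ S) (v₀ : σ) :
    ∃ (Q : Set (Option (TM2.Stmt (fun _ : K => Γ) Λ σ × σ))) (_ : Finite Q)
      (M' : StackMachine Q K Γ) (q₀ : Q), ∀ stk,
        M'.Halts (q₀, stk) ↔ (StateTransition.eval (TM2.step M) ⟨some l₀, v₀, stk⟩).Dom := by
  let T : Set (Option (TM2.Stmt (fun _ : K => Γ) Λ σ × σ)) :=
    {q | ∀ p ∈ q, some p.1 ∈ TM2.stmts M S}
  have hTfin : T.Finite := by
    have : T ⊆ insert none (some '' ((some ⁻¹' (TM2.stmts M S : Set _)) ×ˢ Set.univ)) := by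
      rintro (_ | ⟨q, v⟩) h
      · simp
      · simpa using h _ rfl
    refine Set.Finite.subset (.insert _ (.image _ (.prod ?_ Set.finite_univ))) this
    exact (Finset.finite_toSet _).preimage (Option.some_injective _).injOn
  have hT : ∀ q ∈ T, ∀ t, (ofTM2 M).next q t ∈ T := by
    rintro (_ | ⟨q, v⟩) hq t ⟨q', v'⟩ h
    · cases h
    · exact stmtNext_mem_stmts M hS (hq _ rfl) h
  have hq₀ : some (M l₀, v₀) ∈ T := by
    intro p hp
    obtain rfl : (M l₀, v₀) = p := by simpa using hp
    simp only [TM2.stmts, Finset.some_mem_insertNone, Finset.mem_biUnion]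
    exact ⟨_, hl₀, TM2.stmts₁_self⟩
  refine ⟨T, hTfin, (ofTM2 M).restrict T hT (fun _ h => by cases h), ⟨_, hq₀⟩, fun stk => ?_⟩
  rw [StackMachine.restrict_halts_iff]
  exact ofTM2_halts_iff M ⟨some l₀, v₀, stk⟩

end TM2

/-! ### Stack machines for recursively enumerable sets -/

open Turing.PartrecToTM2 in
instance : Finite Turing.PartrecToTM2.K' :=
  Finite.of_surjective ![K'.main, K'.rev, K'.aux, K'.stack] fun k => by
    cases k
    exacts [⟨0, rfl⟩, ⟨1, rfl⟩, ⟨2, rfl⟩, ⟨3, rfl⟩]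

open Turing Turing.PartrecToTM2 in
/-- Every recursively enumerable set is the halting set of a stack machine with finitely many
states, started with the binary digits of the input on one of its stacks. -/
theorem exists_stackMachine {S : Set ℕ} (hS : REPred fun n => n ∈ S) :
    ∃ (Q : Type) (_ : Finite Q) (M : StackMachine Q K' Γ') (q₀ : Q),
      ∀ n, n ∈ S ↔ M.Halts (q₀, K'.elim (trList [n]) [] [] []) := by
  have hp : Partrec fun n : ℕ => (Part.assert (n ∈ S) fun _ => Part.some ()).map fun _ => 0 :=
    Partrec.map hS (Computable.const 0).to₂
  obtain ⟨c, hc⟩ := ToPartrec.Code.exists_code (Nat.Partrec'.part_iff₁.2 hp)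
  obtain ⟨Q, hQ, M, q₀, hM⟩ := @exists_stackMachine_of_supports _ _ _ _ tr _
    ⟨trNormal c Cont'.halt⟩ _ _ (tr_supports c Cont'.halt) _ (tr_supports c Cont'.halt).1 none
  refine ⟨Q, hQ, M, q₀, fun n => ?_⟩
  refine Iff.trans ?_ (hM _).symm
  change _ ↔ (StateTransition.eval (TM2.step tr) (init c [n])).Dom
  have hcn := hc ⟨[n], rfl⟩
  rw [tr_eval, show c.eval [n] = _ from hcn]
  simp [Part.assert, List.Vector.head]

open Turing Turing.PartrecToTM2 in
theorem trPosNum_eq_map_bits (p : PosNum) :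
    trPosNum p = (p : ℕ).bits.map fun b => bif b then Γ'.bit1 else Γ'.bit0 := by
  induction p with
  | one => simp [trPosNum]
  | bit1 p ih =>
    rw [trPosNum, ih, PosNum.cast_bit1, ← two_mul, Nat.bit1_bits]
    rfl
  | bit0 p ih =>
    rw [trPosNum, ih, PosNum.cast_bit0, ← two_mul, Nat.bit0_bits _ (by
      exact_mod_cast (PosNum.cast_pos p).ne')]
    rfl

open Turing Turing.PartrecToTM2 in
theorem trNat_eq_map_bits (n : ℕ) :
    trNat n = n.bits.map fun b => bif b then Γ'.bit1 else Γ'.bit0 := by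
  rw [trNat]
  have h : ((n : Num) : ℕ) = n := Num.to_of_nat n
  cases hn : (n : Num) with
  | zero =>
    rw [hn] at h
    simp [← h, trNum]
  | pos p =>
    rw [hn] at h
    rw [trNum, trPosNum_eq_map_bits, ← h]
    rfl

open Turing.PartrecToTM2 in
/-- The initial stack content for the input `n`: its binary digits, from the least significant
one, followed by an end marker. -/
theorem getElem?_trList_singleton (n j : ℕ) :
    (trList [n])[j]? = if j = n.size then some Γ'.cons else
      if j < n.size then some (bif n.testBit j then Γ'.bit1 else Γ'.bit0) else none := by
  have hlen : (trNat n).length = n.size := by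
    rw [trNat_eq_map_bits, List.length_map, Nat.size_eq_bits_len]
  simp only [trList]
  split_ifs with h₁ h₂
  · rw [List.getElem?_append_right (by omega), hlen, h₁]
    simp
  · rw [List.getElem?_append_left (by omega), trNat_eq_map_bits, List.getElem?_map,
      Nat.testBit_eq_inth]
    have h₃ : j < n.bits.length := by rwa [Nat.size_eq_bits_len]
    rw [List.getI_eq_getElem _ h₃, List.getElem?_eq_getElem h₃]
    rfl
  · rw [List.getElem?_eq_none]
    simp
    omega

/-! ### Space-time diagrams of stack machines -/

namespace StackMachine

variable {Q K Γ : Type*} (M : StackMachine Q K Γ)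

/-- The local rule for space-time diagrams of a stack machine with `c` rows and `c` columns. Cell
`p = t * c + j` holds the state at time `t` and the `j`-th entries (from the top) of all stacks at
time `t`, `none` standing for an entry beyond the bottom of the stack. The rule relates a cell `a`
to its right neighbour `ar`, the cell `ad` at the next time, and the right neighbour `adr` of `ad`.
The propositions `first`, `last`, `left`, `right` say that `a` lies on the respective border, and
`init` are the entries prescribed for `a` if it is in the first row. -/
structure LocallyValid (q₀ : Q) (init : K → Option Γ) (first last left right : Prop)
    (a ar ad adr : Q × (K → Option Γ)) : Prop where
  start : first → a = (q₀, init)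
  halt : last → a.1 = M.halt
  blank : right → ∀ k, a.2 k = none
  row : ¬right → ar.1 = a.1
  next : ¬last → left → ad.1 = M.next a.1 a.2
  push_top : ¬last → left → ∀ k g, M.act a.1 k = .push g → ad.2 k = some g
  push : ¬last → ¬right → ∀ k g, M.act a.1 k = .push g → adr.2 k = a.2 k
  pop : ¬last → ¬right → ∀ k, M.act a.1 k = .pop → ad.2 k = ar.2 k
  keep : ¬last → ¬right → ∀ k, M.act a.1 k = .keep → ad.2 k = a.2 k

/-- `s` is a space-time diagram with `c` rows and columns of an accepting run of `M`, where `init p`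
are the entries of the stacks at depth `p` at the start. -/
def IsDiagram (q₀ : Q) (init : ℕ → K → Option Γ) (c : ℕ) (s : ℕ → Q × (K → Option Γ)) : Prop :=
  ∀ p < c * c, M.LocallyValid q₀ (init p) (p < c) (c * c - c ≤ p) (p % c = 0) (p % c = c - 1)
    (s p) (s (p + 1)) (s (p + c)) (s (p + c + 1))

variable {M}

/-- The cell contents that a configuration gives in column `j`. -/
def cell (c : Q × (K → List Γ)) (j : ℕ) : Q × (K → Option Γ) :=
  (c.1, fun k => (c.2 k)[j]?)

variable {q₀ : Q} {S : K → List Γ} {c : ℕ}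

/-- A diagram is the record of the run: by induction on the row, the local rule determines all
entries. The blank last column guarantees that no stack grows beyond the width of the diagram. -/
theorem IsDiagram.eq_cell {s : ℕ → Q × (K → Option Γ)}
    (h : M.IsDiagram q₀ (fun p k => (S k)[p]?) c s) {t : ℕ} (ht : t < c) {j : ℕ} (hj : j < c) :
    s (t * c + j) = cell (M.step^[t] (q₀, S)) j := by
  have hlt {t j : ℕ} (ht : t < c) (hj : j < c) : t * c + j < c * c := by nlinarith
  have hmod {t j : ℕ} (hj : j < c) : (t * c + j) % c = j := by
    rw [Nat.mul_add_mod_self_right, Nat.mod_eq_of_lt hj]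
  have hlast {t j : ℕ} (ht : t + 1 < c) (hj : j < c) : ¬c * c - c ≤ t * c + j := by
    have : (t + 1) * c + c ≤ c * c := by nlinarith
    rw [add_mul] at this
    omega
  induction t generalizing j with
  | zero =>
    have := (h j (by nlinarith)).start hj
    simpa [cell] using this
  | succ t ih =>
    replace ih {j : ℕ} (hj : j < c) := ih (by omega) hj
    rw [Function.iterate_succ_apply']
    set C := M.step^[t] (q₀, S)
    have hC (k : K) : (C.2 k)[c - 1]? = none := by
      have := (h (t * c + (c - 1)) (hlt (by omega) (by omega))).blank (hmod (by omega)) k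
      rw [ih (by omega)] at this
      exact this
    -- The local rule at column `j` of row `t`, with row `t` known by induction.
    have rule {j : ℕ} (hj : j < c) := h (t * c + j) (hlt (by omega) hj)
    have e₁ (j : ℕ) : t * c + j + c = (t + 1) * c + j := by ring
    simp only [e₁] at rule
    have hrow : ∀ {j : ℕ}, j < c → (s ((t + 1) * c + j)).1 = (M.step C).1 := by
      intro j hj
      induction j with
      | zero =>
        have := (rule hj).next (hlast ht hj) (hmod hj)
        rw [this, ih hj]
        simp [cell, step, List.head?_eq_getElem?]
      | succ j ihj =>
        have := (h ((t + 1) * c + j) (hlt ht (by omega))).row (by rw [hmod (by omega)]; omega)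
        rw [← ihj (by omega), ← this]
        rfl
    refine Prod.ext (hrow hj) (funext fun k => ?_)
    have hnone : j = c - 1 → (s ((t + 1) * c + j)).2 k = none := fun e =>
      (h _ (hlt ht hj)).blank ((hmod hj).trans e) k
    have hlen := List.getElem?_eq_none_iff.1 (hC k)
    have hst : (cell (M.step C) j).2 k = ((M.act C.1 k).apply (C.2 k))[j]? := rfl
    rw [hst]
    have hact {j : ℕ} (hj : j < c) : M.act (s (t * c + j)).1 k = M.act C.1 k := by rw [ih hj]; rfl
    cases hA : M.act C.1 k with
    | keep =>
      by_cases hj' : j = c - 1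
      · rw [hnone hj', hj']
        exact (hC k).symm
      · rw [(rule hj).keep (hlast ht hj) (by rw [hmod hj]; exact hj') k ((hact hj).trans hA), ih hj]
        rfl
    | pop =>
      by_cases hj' : j = c - 1
      · rw [hnone hj', eq_comm, List.getElem?_eq_none_iff, StackAction.apply, List.length_tail]
        omega
      · rw [(rule hj).pop (hlast ht hj) (by rw [hmod hj]; exact hj') k ((hact hj).trans hA),
          add_assoc, ih (by omega), StackAction.apply, List.getElem?_tail]
        rfl
    | push g =>
      cases j with
      | zero =>
        rw [(rule hj).push_top (hlast ht hj) (hmod hj) k g ((hact hj).trans hA)]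
        rfl
      | succ j =>
        have hj' : j < c := by omega
        have := (rule hj').push (hlast ht hj') (by rw [hmod hj']; omega) k g ((hact hj').trans hA)
        rw [add_assoc] at this
        rw [this, ih hj']
        rfl

theorem IsDiagram.halts {s : ℕ → Q × (K → Option Γ)} (hc : 0 < c)
    (h : M.IsDiagram q₀ (fun p k => (S k)[p]?) c s) : M.Halts (q₀, S) := by
  refine ⟨c - 1, ?_⟩
  have hp : (c - 1) * c + 0 = c * c - c := by rw [add_zero, Nat.sub_one_mul]
  have hle : c ≤ c * c := Nat.le_mul_self c
  have := (h ((c - 1) * c + 0) (by omega)).halt hp.ge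
  rwa [h.eq_cell (by omega) hc] at this

/-- An accepting run has a diagram of every large size, the halting configuration being repeated
until the last row. -/
theorem exists_isDiagram [Finite K] (h : M.Halts (q₀, S)) :
    ∃ c₀, ∀ c ≥ c₀, ∃ s, M.IsDiagram q₀ (fun p k => (S k)[p]?) c s := by
  obtain ⟨n, hn⟩ := h
  obtain ⟨b, hb⟩ := (Set.finite_range fun k => (S k).length).bddAbove
  refine ⟨b + n + 2, fun c hc => ?_⟩
  -- After time `n` the configuration does not change, so the stacks stay shorter than `c`.
  have hlen (t : ℕ) (k : K) : ((M.step^[t] (q₀, S)).2 k).length < c - 1 := by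
    have hk : (S k).length ≤ b := hb ⟨k, rfl⟩
    rcases le_total t n with htn | htn
    · have := M.length_iterate_step_le (q₀, S) k t
      dsimp only at this
      omega
    · rw [M.iterate_step_eq hn htn]
      have := M.length_iterate_step_le (q₀, S) k n
      dsimp only at this
      omega
  let s (p : ℕ) := cell (M.step^[p / c] (q₀, S)) (p % c)
  have hs (t : ℕ) {j : ℕ} (hj : j < c) : s (t * c + j) = cell (M.step^[t] (q₀, S)) j := by
    simp only [s]
    rw [Nat.mul_add_mod_self_right, Nat.mod_eq_of_lt hj, mul_comm, Nat.mul_add_div (by omega),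
      Nat.div_eq_of_lt hj, add_zero]
  refine ⟨s, fun p hp => ?_⟩
  obtain ⟨t, j, hj, rfl⟩ : ∃ t j, j < c ∧ p = t * c + j :=
    ⟨p / c, p % c, Nat.mod_lt _ (by omega), (Nat.div_add_mod' p c).symm⟩
  have hr (hj' : ¬j = c - 1) : s (t * c + j + 1) = cell (M.step^[t] (q₀, S)) (j + 1) :=
    hs t (j := j + 1) (by omega)
  have hd : s (t * c + j + c) = cell (M.step (M.step^[t] (q₀, S))) j := by
    rw [show t * c + j + c = (t + 1) * c + j by ring, hs _ hj, Function.iterate_succ_apply']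
  have hdr (hj' : ¬j = c - 1) :
      s (t * c + j + c + 1) = cell (M.step (M.step^[t] (q₀, S))) (j + 1) := by
    rw [show t * c + j + c + 1 = (t + 1) * c + (j + 1) by ring, hs _ (by omega),
      Function.iterate_succ_apply']
  rw [Nat.mul_add_mod_self_right, Nat.mod_eq_of_lt hj, hs t hj, hd]
  constructor
  · intro hfirst
    obtain rfl : t = 0 := by
      by_contra ht
      have : 1 * c ≤ t * c := Nat.mul_le_mul_right c (by omega)
      omega
    simp [cell]
  · intro hlast
    have ht : n ≤ t := by
      by_contra ht
      have : (t + 2) * c ≤ c * c := Nat.mul_le_mul_right c (by omega)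
      rw [add_mul] at this
      omega
    simp only [cell, M.iterate_step_eq hn ht, hn]
  · rintro rfl k
    exact List.getElem?_eq_none (hlen t k).le
  · intro hj'
    rw [hr hj']
    rfl
  · rintro - rfl
    simp [cell, step, List.head?_eq_getElem?]
  · rintro - rfl k g hA
    simp only [cell] at hA
    simp [cell, step, hA, StackAction.apply]
  · rintro - hj' k g hA
    simp only [cell] at hA
    simp [hdr hj', cell, step, hA, StackAction.apply]
  · rintro - hj' k hA
    simp only [cell] at hA
    simp [hr hj', cell, step, hA, StackAction.apply]
  · rintro - hj' k hA
    simp only [cell] at hA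
    simp [cell, step, hA, StackAction.apply]

end StackMachine

/-! ### Numbers made of fields of equal width -/

/-- The number that consists of `N` bit fields of width `W`, the `i`-th of them containing `f i`. -/
def fieldSum (W N : ℕ) (f : ℕ → ℕ) : ℕ :=
  ∑ i ∈ Finset.range N, f i * 2 ^ (W * i)

theorem fieldSum_succ (W N : ℕ) (f : ℕ → ℕ) :
    fieldSum W (N + 1) f = fieldSum W N f + f N * 2 ^ (W * N) :=
  Finset.sum_range_succ _ _

theorem fieldSum_add (W N : ℕ) (f g : ℕ → ℕ) :
    fieldSum W N f + fieldSum W N g = fieldSum W N fun i => f i + g i := by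
  simp only [fieldSum, add_mul, Finset.sum_add_distrib]

theorem fieldSum_lt {W N : ℕ} {f : ℕ → ℕ} (hf : ∀ i < N, f i < 2 ^ W) :
    fieldSum W N f < 2 ^ (W * N) := by
  induction N with
  | zero => simp [fieldSum]
  | succ N ih =>
    rw [fieldSum_succ, Nat.mul_succ, pow_add]
    have h₁ := ih fun i hi => hf i (by omega)
    have h₂ := hf N (by omega)
    nlinarith

theorem testBit_fieldSum {W N : ℕ} (hW : 0 < W) {f : ℕ → ℕ} (hf : ∀ i < N, f i < 2 ^ W) (n : ℕ) :
    (fieldSum W N f).testBit n = (decide (n / W < N) && (f (n / W)).testBit (n % W)) := by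
  induction N with
  | zero => simp [fieldSum]
  | succ N ih =>
    have hf' : ∀ i < N, f i < 2 ^ W := fun i hi => hf i (by omega)
    rw [fieldSum_succ, add_comm, mul_comm, Nat.testBit_two_pow_mul_add _ (fieldSum_lt hf'), ih hf']
    have hdiv : n / W < N ↔ n < W * N := by rw [Nat.div_lt_iff_lt_mul hW, mul_comm]
    split_ifs with h
    · simp [hdiv.2 h, (hdiv.2 h).trans (Nat.lt_succ_self N)]
    · rcases (Nat.lt_or_ge N (n / W)) with h' | h'
      · have hle : W ≤ n - W * N := by
          have := (Nat.le_div_iff_mul_le hW).1 h'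
          rw [Nat.succ_mul, mul_comm] at this
          omega
        rw [Nat.testBit_lt_two_pow ((hf N (by omega)).trans_le (Nat.pow_le_pow_right two_pos hle))]
        simp [h']
      · have e : n / W = N := le_antisymm h' (not_lt.1 (hdiv.not.2 h))
        have := Nat.div_add_mod n W
        rw [e] at this ⊢
        rw [show n - W * N = n % W by omega]
        simp

theorem testBit_fieldSum_mul_add {W N : ℕ} {f : ℕ → ℕ} (hf : ∀ i < N, f i < 2 ^ W) {i q : ℕ}
    (hi : i < N) (hq : q < W) : (fieldSum W N f).testBit (W * i + q) = (f i).testBit q := by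
  rw [testBit_fieldSum (by omega) hf, Nat.mul_add_div (by omega), Nat.div_eq_of_lt hq,
    Nat.mul_add_mod_self_left, Nat.mod_eq_of_lt hq]
  simp [hi]

theorem eq_fieldSum {W N E : ℕ} (hW : 0 < W) (hE : E < 2 ^ (W * N)) :
    E = fieldSum W N fun i => E / 2 ^ (W * i) % 2 ^ W := by
  refine Nat.eq_of_testBit_eq fun n => ?_
  rw [testBit_fieldSum hW fun i _ => Nat.mod_lt _ (by positivity), Nat.testBit_mod_two_pow,
    Nat.testBit_div_two_pow, Nat.mod_add_div]
  rcases Nat.lt_or_ge (n / W) N with h | h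
  · simp [h, Nat.mod_lt _ hW]
  · have : W * N ≤ n := by rw [mul_comm]; exact (Nat.le_div_iff_mul_le hW).1 h
    rw [Nat.testBit_lt_two_pow (hE.trans_le (Nat.pow_le_pow_right two_pos this))]
    simp

/-- A geometric sum. -/
theorem fieldSum_const_mul (W N v : ℕ) :
    fieldSum W N (fun _ => v) * (2 ^ W - 1) = v * 2 ^ (W * N) - v := by
  obtain ⟨z, hz⟩ : ∃ z, 2 ^ W = z + 1 := Nat.exists_eq_succ_of_ne_zero (by positivity)
  refine Nat.eq_sub_of_add_eq ?_
  rw [hz, Nat.add_sub_cancel]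
  induction N with
  | zero => simp [fieldSum]
  | succ N ih =>
    rw [fieldSum_succ, Nat.mul_succ, pow_add, hz]
    linear_combination ih

/-- The numbers `N - 1, …, 1, 0` as consecutive fields. -/
theorem mul_fieldSum_sub_add (W N : ℕ) :
    (2 ^ W - 1) * fieldSum W N (fun i => N - 1 - i) + N = fieldSum W N fun _ => 1 := by
  obtain ⟨z, hz⟩ : ∃ z, 2 ^ W = z + 1 := Nat.exists_eq_succ_of_ne_zero (by positivity)
  induction N with
  | zero => simp [fieldSum]
  | succ N ih =>
    have h : fieldSum W (N + 1) (fun i => N + 1 - 1 - i) =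
        fieldSum W N (fun i => N - 1 - i) + fieldSum W N fun _ => 1 := by
      rw [fieldSum_succ, fieldSum_add]
      simp only [add_tsub_cancel_right, tsub_self, zero_mul, add_zero]
      refine Finset.sum_congr rfl fun i hi => ?_
      rw [Finset.mem_range] at hi
      beta_reduce
      rw [show N - i = N - 1 - i + 1 by omega]
    have hg := fieldSum_const_mul W N 1
    rw [one_mul, hz, Nat.add_sub_cancel] at hg
    have hpos : 1 ≤ 2 ^ (W * N) := Nat.one_le_two_pow
    rw [h, fieldSum_succ]
    rw [hz, Nat.add_sub_cancel] at ih ⊢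
    zify [hpos] at hg ih ⊢
    linear_combination ih + hg

/-- A test of all fields of `E` for being nonzero, where only the lowest `D` bits of each field may
be `1`: adding `2 ^ D - 1` to a field carries into its bit `D` iff the field is not `0`. -/
theorem add_land_eq_iff {W N D E : ℕ} (hD : D < W) (hE : E < 2 ^ (W * N))
    (hE' : ∀ i < N, ∀ q < W, D ≤ q → E.testBit (W * i + q) = false) :
    (E + fieldSum W N fun _ => 2 ^ D - 1) &&& (fieldSum W N fun _ => 2 ^ D) =
        (fieldSum W N fun _ => 2 ^ D) ↔
      ∀ i < N, ∃ q < D, E.testBit (W * i + q) = true := by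
  have hW : 0 < W := by omega
  let d (i : ℕ) := E / 2 ^ (W * i) % 2 ^ W
  have hbit (i q : ℕ) : (d i).testBit q = (decide (q < W) && E.testBit (W * i + q)) := by
    simp only [d]
    rw [Nat.testBit_mod_two_pow, Nat.testBit_div_two_pow, add_comm q]
  have hd : ∀ i < N, d i < 2 ^ D := by
    refine fun i hi => Nat.lt_pow_two_of_testBit _ fun q hq => ?_
    rw [hbit]
    by_cases hqW : q < W
    · simp [hE' i hi q hqW hq]
    · simp [hqW]
  have hpow : 2 ^ (D + 1) ≤ 2 ^ W := Nat.pow_le_pow_right two_pos hD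
  have hpow' : 2 ^ (D + 1) = 2 ^ D + 2 ^ D := by ring
  have hpos : 0 < 2 ^ D := by positivity
  have hsum : ∀ i < N, d i + (2 ^ D - 1) < 2 ^ W := fun i hi => by have := hd i hi; omega
  have hH : ∀ i < N, 2 ^ D < 2 ^ W := fun _ _ => by omega
  have hcarry : ∀ i < N, ((d i + (2 ^ D - 1)).testBit D = true ↔
      ∃ q < D, E.testBit (W * i + q) = true) := by
    intro i hi
    by_cases h0 : d i = 0
    · rw [h0, zero_add, Nat.testBit_two_pow_sub_one]
      simp only [lt_self_iff_false, decide_false, Bool.false_eq_true, false_iff]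
      rintro ⟨q, hq, h⟩
      have := hbit i q
      rw [h0, h] at this
      simp at this
      omega
    · rw [show d i + (2 ^ D - 1) = 2 ^ D + (d i - 1) by omega, Nat.testBit_two_pow_add_eq,
        Nat.testBit_lt_two_pow (by have := hd i hi; omega)]
      simp only [Bool.not_false, true_iff]
      obtain ⟨q, hq⟩ := Nat.exists_testBit_of_ne_zero h0
      have hqD : q < D := by
        by_contra hqD
        rw [Nat.testBit_lt_two_pow ((hd i hi).trans_le
          (Nat.pow_le_pow_right two_pos (not_lt.1 hqD)))] at hq
        simp at hq
      refine ⟨q, hqD, ?_⟩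
      rw [hbit] at hq
      simp only [Bool.and_eq_true] at hq
      exact hq.2
  have hEd : E = fieldSum W N d := eq_fieldSum hW hE
  conv_lhs => rw [hEd, fieldSum_add]
  constructor
  · intro h i hi
    rw [← hcarry i hi]
    have := congrArg (Nat.testBit · (W * i + D)) h
    simp only [Nat.testBit_and] at this
    rw [testBit_fieldSum_mul_add hsum hi hD, testBit_fieldSum_mul_add hH hi hD] at this
    simpa using this
  · intro h
    refine Nat.eq_of_testBit_eq fun n => ?_
    rw [Nat.testBit_and, testBit_fieldSum hW hsum, testBit_fieldSum hW hH, Nat.testBit_two_pow]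
    by_cases hn : n / W < N
    · by_cases hnD : D = n % W
      · simp [hn, ← hnD, (hcarry _ hn).2 (h _ hn)]
      · simp [hnD]
    · simp [hn]

namespace Computed

/-- The number with `N` fields that all contain `v`, as the exact quotient
`(v * 2 ^ (W * N) - v) / (2 ^ W - 1)`. -/
theorem replicate {v W P N : ℕ → ℕ → ℕ} (hv : Computed v) (hW : Computed W) (hP : Computed P)
    (h0 : ∀ inp x, 0 < W inp x) (hN : ∀ inp x, P inp x = W inp x * N inp x) :
    Computed fun inp x => fieldSum (W inp x) (N inp x) fun _ => v inp x := by
  have h2 (inp x : ℕ) : 2 ^ W inp x - 1 ≠ 0 := by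
    have := Nat.one_lt_two_pow (h0 inp x).ne'
    omega
  have key (inp x : ℕ) := fieldSum_const_mul (W inp x) (N inp x) (v inp x)
  have hnum : Computed fun inp x => v inp x * 2 ^ P inp x - v inp x :=
    (hv.shiftLeft hP).sub hv fun inp x => Nat.le_mul_of_pos_right _ (by positivity)
  have hden : Computed fun inp x => 2 ^ W inp x - 1 :=
    hW.two_pow.sub Computed.one fun _ _ => Nat.one_le_two_pow
  convert hnum.div hden h2 fun inp x => ?_ using 3 with inp x
  · rw [hN, ← key]
    exact (Nat.mul_div_cancel _ (Nat.pos_of_ne_zero (h2 inp x))).symm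
  · rw [hN, ← key]
    exact dvd_mul_left _ _

/-- All numbers below `2 ^ W`, listed in one number in descending order. -/
theorem enumeration {W : ℕ → ℕ → ℕ} (hW : Computed W) (h0 : ∀ inp x, 0 < W inp x) :
    Computed fun inp x => fieldSum (W inp x) (2 ^ W inp x) fun i => 2 ^ W inp x - 1 - i := by
  have h2 (inp x : ℕ) : 2 ^ W inp x - 1 ≠ 0 := by
    have := Nat.one_lt_two_pow (h0 inp x).ne'
    omega
  have key (inp x : ℕ) := mul_fieldSum_sub_add (W inp x) (2 ^ W inp x)
  have hrep := replicate Computed.one hW (hW.shiftLeft hW) h0 (N := fun inp x => 2 ^ W inp x)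
    fun _ _ => rfl
  have hnum := hrep.sub hW.two_pow fun inp x => by rw [← key]; exact Nat.le_add_left _ _
  have hden : Computed fun inp x => 2 ^ W inp x - 1 :=
    hW.two_pow.sub Computed.one fun _ _ => Nat.one_le_two_pow
  convert hnum.div hden h2 fun inp x => ?_ using 3 with inp x
  · rw [← key, Nat.add_sub_cancel]
    exact (Nat.mul_div_cancel_left _ (Nat.pos_of_ne_zero (h2 inp x))).symm
  · rw [← key, Nat.add_sub_cancel]
    exact dvd_mul_right _ _

end Computed

/-! ### Searching for a diagram in parallel -/

/-- Where the position `p` lies in a `c` by `c` diagram (in the first row, last row, first column,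
last column), and the digits of the input at position `p`: its bit, whether there still is a digit,
and whether the digits have just ended. -/
def flags (inp c p : ℕ) : Fin 7 → Bool :=
  ![decide (p < c), decide (c * c - c ≤ p), decide (p % c = 0), decide (p % c = c - 1),
    inp.testBit p, decide (p < inp.size), decide (p = inp.size)]

/-- The distances of the cells that the local rule for a cell involves. -/
def offset (c : ℕ) : Fin 4 → ℕ :=
  ![0, 1, c, c + 1]

/-- For `c = 2 ^ x`, the numbers whose bits at the positions `p < c * c` are the `flags`. -/
def flagMask : Fin 7 → ℕ → ℕ → ℕ :=
  ![fun _ x => 2 ^ 2 ^ x - 1,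
    fun _ x => (2 ^ 2 ^ x - 1) * 2 ^ (2 ^ (x + x) - 2 ^ x),
    fun _ x => fieldSum (2 ^ x) (2 ^ x) fun _ => 1,
    fun _ x => fieldSum (2 ^ x) (2 ^ x) fun _ => 2 ^ (2 ^ x - 1),
    fun inp _ => inp,
    fun inp _ => 2 ^ inp.size - 1,
    fun inp _ => 2 ^ inp.size]

theorem computed_two_pow_snd : Computed fun _ x => 2 ^ x := Computed.snd.two_pow

theorem computed_area : Computed fun _ x => 2 ^ (x + x) :=
  (Computed.snd.add Computed.snd).two_pow

theorem computed_flagMask (i : Fin 7) : Computed (flagMask i) := by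
  have hc := computed_two_pow_snd
  have h1 : Computed fun _ x => 2 ^ 2 ^ x - 1 :=
    hc.two_pow.sub Computed.one fun _ _ => Nat.one_le_two_pow
  have hrep {v : ℕ → ℕ → ℕ} (hv : Computed v) :
      Computed fun inp x => fieldSum (2 ^ x) (2 ^ x) fun _ => v inp x :=
    .replicate hv hc computed_area (fun _ _ => by positivity) fun _ _ => pow_add _ _ _
  fin_cases i
  · exact h1
  · exact h1.shiftLeft (computed_area.sub hc fun _ x => Nat.pow_le_pow_right two_pos (by omega))
  · exact hrep Computed.one
  · exact hrep (hc.sub Computed.one fun _ _ => Nat.one_le_two_pow).two_pow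
  · exact Computed.fst
  · exact Computed.fst.two_pow_size.sub Computed.one fun _ _ => Nat.one_le_two_pow
  · exact Computed.fst.two_pow_size

theorem testBit_flagMask {inp x p : ℕ} (hp : p < 2 ^ x * 2 ^ x) (i : Fin 7) :
    (flagMask i inp x).testBit p = flags inp (2 ^ x) p i := by
  have hc : 0 < 2 ^ x := by positivity
  have hdiv : p / 2 ^ x < 2 ^ x := Nat.div_lt_of_lt_mul hp
  have hcc : 2 ^ x ≤ 2 ^ x * 2 ^ x := Nat.le_mul_self _
  have hpow : 2 ^ (2 ^ x - 1) < 2 ^ 2 ^ x := Nat.pow_lt_pow_right (by norm_num) (by omega)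
  fin_cases i
  · simp [flagMask, flags, Nat.testBit_two_pow_sub_one]
  · simp [flagMask, flags, Nat.testBit_two_pow_sub_one, Nat.testBit_mul_two_pow, pow_add]
    omega
  · simp only [flagMask, flags]
    change (fieldSum (2 ^ x) (2 ^ x) fun _ => 1).testBit p = decide (p % 2 ^ x = 0)
    rw [testBit_fieldSum hc fun _ _ => Nat.one_lt_two_pow hc.ne']
    rw [Bool.eq_iff_iff]
    simp [hdiv, Nat.testBit_one_eq_true_iff_self_eq_zero]
  · change (fieldSum (2 ^ x) (2 ^ x) fun _ => 2 ^ (2 ^ x - 1)).testBit p =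
      decide (p % 2 ^ x = 2 ^ x - 1)
    rw [testBit_fieldSum hc fun _ _ => hpow]
    simp [hdiv, Nat.testBit_two_pow, eq_comm]
  · rfl
  · simp [flagMask, flags, Nat.testBit_two_pow_sub_one]
  · simp [flagMask, flags, Nat.testBit_two_pow, eq_comm]

theorem flagMask_lt {inp x : ℕ} (h : inp.size < 2 ^ x * 2 ^ x) (i : Fin 7) :
    flagMask i inp x < 2 ^ (2 ^ x * 2 ^ x) := by
  have hc : 0 < 2 ^ x := by positivity
  have hcc : 2 ^ x ≤ 2 ^ x * 2 ^ x := Nat.le_mul_self _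
  have hpow : 2 ^ (2 ^ x - 1) < 2 ^ 2 ^ x := Nat.pow_lt_pow_right (by norm_num) (by omega)
  have hpow' : 2 ^ 2 ^ x ≤ 2 ^ (2 ^ x * 2 ^ x) := Nat.pow_le_pow_right two_pos hcc
  have hsize : 2 ^ inp.size < 2 ^ (2 ^ x * 2 ^ x) := Nat.pow_lt_pow_right (by norm_num) h
  have hsub (a : ℕ) : 2 ^ a - 1 < 2 ^ a := Nat.sub_lt (by positivity) one_pos
  fin_cases i
  · exact (hsub _).trans_le hpow'
  · change (2 ^ 2 ^ x - 1) * 2 ^ (2 ^ (x + x) - 2 ^ x) < _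
    calc (2 ^ 2 ^ x - 1) * 2 ^ (2 ^ (x + x) - 2 ^ x)
        < 2 ^ 2 ^ x * 2 ^ (2 ^ (x + x) - 2 ^ x) :=
          Nat.mul_lt_mul_of_pos_right (hsub _) (by positivity)
      _ = 2 ^ (2 ^ x * 2 ^ x) := by rw [← pow_add, pow_add 2 x x, Nat.add_sub_cancel' hcc]
  · exact fieldSum_lt fun _ _ => Nat.one_lt_two_pow hc.ne'
  · exact fieldSum_lt fun _ _ => hpow
  · exact (Nat.lt_size_self inp).trans hsize
  · exact (hsub _).trans hsize
  · exact hsize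

/-- For an arbitrary local rule `ok` on cells of `B` bits, straight-line code decides, for all
large `x`, whether there is a `2 ^ x` by `2 ^ x` diagram that obeys the rule everywhere. -/
theorem exists_computed_search (B : ℕ)
    (ok : (Fin 7 → Bool) → (Fin 4 → Fin B → Bool) → Bool) :
    ∃ F G : ℕ → ℕ → ℕ, Computed F ∧ Computed G ∧ ∀ inp, ∃ x₀, ∀ x ≥ x₀,
      (F inp x ≠ G inp x ↔ ∃ y : ℕ → Fin B → Bool, ∀ p < 2 ^ x * 2 ^ x,
        ok (flags inp (2 ^ x) p) (fun d => y (p + offset (2 ^ x) d)) = true) := by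
  -- A candidate is a number below `2 ^ W` whose bit `b * S + p` is bit `b` of cell `p`. The stride
  -- `S` is twice the area `L`, so that also the neighbours of cells in the last row have a place.
  let L (x : ℕ) := 2 ^ (x + x)
  let S (x : ℕ) := 2 ^ (x + x + 1)
  let W (x : ℕ) := 2 ^ (x + x + 1 + (B + 2))
  -- The checks for candidate `i` take place in field `i`, from bit `D` onwards.
  let D (x : ℕ) := (B + 1) * S x
  let X (x : ℕ) := fieldSum (W x) (2 ^ W x) fun i => 2 ^ W x - 1 - i
  let rep (v : ℕ → ℕ → ℕ) (inp x : ℕ) := fieldSum (W x) (2 ^ W x) fun _ => v inp x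
  have cS : Computed fun _ x => S x :=
    ((Computed.snd.add Computed.snd).add Computed.one).two_pow
  have cW : Computed fun _ x => W x :=
    (((Computed.snd.add Computed.snd).add Computed.one).add (.const _)).two_pow
  have cD : Computed fun _ x => D x := cS.const_mul _
  have hW0 (x : ℕ) : 0 < W x := by positivity
  have cX : Computed fun _ x => X x := .enumeration cW fun _ x => hW0 x
  have crep {v : ℕ → ℕ → ℕ} (hv : Computed v) : Computed (rep v) :=
    .replicate hv cW (cW.shiftLeft cW) (fun _ x => hW0 x) fun _ _ => rfl
  have hLS (x : ℕ) : S x = 2 * L x := by simp only [S, L]; ring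
  have hLc (x : ℕ) : L x = 2 ^ x * 2 ^ x := pow_add _ _ _
  have hSW (x : ℕ) : (B + 3) * S x ≤ W x := by
    have : B + 3 ≤ 2 ^ (B + 2) := (B + 2).lt_two_pow_self
    simp only [W, pow_add 2 (x + x + 1) (B + 2)]
    rw [mul_comm]
    exact Nat.mul_le_mul_left _ this
  have coffset (d : Fin 4) : Computed fun _ x => offset (2 ^ x) d := by
    have hc := computed_two_pow_snd
    fin_cases d
    exacts [.const 0, .const 1, hc, hc.add (.const 1)]
  have hoffset (x : ℕ) (d : Fin 4) : offset (2 ^ x) d ≤ S x := by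
    have h1 : 1 ≤ 2 ^ x := Nat.one_le_two_pow
    have h2 : 2 ^ x ≤ L x := Nat.pow_le_pow_right two_pos (by omega)
    have h3 := hLS x
    fin_cases d <;> simp [offset] <;> omega
  have hshift (x : ℕ) (d : Fin 4) (b : Fin B) : b * S x + offset (2 ^ x) d ≤ D x := by
    have h1 := hoffset x d
    have h2 : (b : ℕ) * S x ≤ B * S x := Nat.mul_le_mul_right _ b.2.le
    simp only [D, add_mul]
    omega
  -- The operands of the Boolean function: the cells to check, the flags, and the bit planes of
  -- all candidates, shifted such that the bits that a check involves have the same position.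
  let P : Option (Fin 7 ⊕ Fin 4 × Fin B) → ℕ → ℕ → ℕ
    | none => rep fun _ x => (2 ^ L x - 1) * 2 ^ D x
    | some (.inl i) => rep fun inp x => flagMask i inp x * 2 ^ D x
    | some (.inr (d, b)) => fun _ x => X x * 2 ^ (D x - (b * S x + offset (2 ^ x) d))
  have cP : ∀ i, Computed (P i) := by
    rintro (_ | i | ⟨d, b⟩)
    · exact crep ((computed_area.two_pow.sub Computed.one
        fun _ _ => Nat.one_le_two_pow).shiftLeft cD)
    · exact crep ((computed_flagMask i).shiftLeft cD)
    · exact cX.shiftLeft (cD.sub ((cS.const_mul b).add (coffset d)) fun _ x => hshift x d b)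
  obtain ⟨E, cE, hE⟩ := Computed.exists_bitwise cP
    (fun v => v none && !ok (fun i => v (some (.inl i))) fun d b => v (some (.inr (d, b)))) rfl
  beta_reduce at hE
  have cDL : Computed fun _ x => 2 ^ (D x + L x) := (cD.add computed_area).two_pow
  have cH := crep cDL
  have cM := crep (cDL.sub Computed.one fun _ _ => Nat.one_le_two_pow)
  refine ⟨_, _, (cE.add cM).land cH, cH, fun inp => ?_⟩
  refine ⟨inp.size + 1, fun x hx => ?_⟩
  have hsize : inp.size < 2 ^ x * 2 ^ x := by
    have h1 : x < 2 ^ x := x.lt_two_pow_self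
    have h2 : 2 ^ x ≤ 2 ^ x * 2 ^ x := Nat.le_mul_self _
    omega
  have hDL : D x + L x < W x := by
    have h1 := hSW x
    have h2 := hLS x
    have h3 : 0 < L x := by positivity
    simp only [D]
    rw [add_mul] at h1 ⊢
    omega
  -- Bits of the operands.
  have hmask {v : ℕ} (hv : v < 2 ^ L x) : v * 2 ^ D x < 2 ^ W x := by
    calc v * 2 ^ D x < 2 ^ L x * 2 ^ D x := Nat.mul_lt_mul_of_pos_right hv (by positivity)
      _ = 2 ^ (D x + L x) := by rw [← pow_add, add_comm]
      _ ≤ 2 ^ W x := Nat.pow_le_pow_right two_pos hDL.le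
  have hones : 2 ^ L x - 1 < 2 ^ L x := Nat.sub_lt (by positivity) one_pos
  have hnone (n : ℕ) : (P none inp x).testBit n = (decide (n / W x < 2 ^ W x) &&
      (decide (D x ≤ n % W x) && decide (n % W x - D x < L x))) := by
    simp only [P, rep]
    rw [testBit_fieldSum (hW0 x) fun _ _ => hmask hones, Nat.testBit_mul_two_pow,
      Nat.testBit_two_pow_sub_one]
  have hflag {i p : ℕ} (hi : i < 2 ^ W x) (hp : p < L x) (j : Fin 7) :
      (P (some (.inl j)) inp x).testBit (W x * i + (D x + p)) = flags inp (2 ^ x) p j := by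
    simp only [P, rep]
    rw [testBit_fieldSum_mul_add (fun _ _ => hmask (by rw [hLc]; exact flagMask_lt hsize j)) hi
      (by omega), Nat.testBit_mul_two_pow, Nat.add_sub_cancel_left,
      testBit_flagMask (by rwa [← hLc])]
    simp
  have hplane {i p : ℕ} (hi : i < 2 ^ W x) (hp : p < L x) (d : Fin 4) (b : Fin B) :
      (P (some (.inr (d, b))) inp x).testBit (W x * i + (D x + p)) =
        (2 ^ W x - 1 - i).testBit (b * S x + (p + offset (2 ^ x) d)) := by
    have h1 := hshift x d b
    simp only [P, X]
    rw [Nat.testBit_mul_two_pow, show W x * i + (D x + p) - (D x - (b * S x + offset (2 ^ x) d)) =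
      W x * i + (b * S x + (p + offset (2 ^ x) d)) by omega,
      testBit_fieldSum_mul_add (fun _ _ => by
        have : 0 < 2 ^ W x := by positivity
        omega) hi (by omega)]
    simp only [Bool.and_eq_right_iff_imp, decide_eq_true_eq]
    omega
  have hE_lt : E inp x < 2 ^ (W x * 2 ^ W x) := by
    refine Nat.lt_pow_two_of_testBit _ fun n hn => ?_
    have : ¬n / W x < 2 ^ W x := by
      rw [not_lt, Nat.le_div_iff_mul_le (hW0 x), mul_comm]
      exact hn
    rw [hE, hnone]
    simp [this]
  have hdm {i q : ℕ} (hq : q < W x) : (W x * i + q) / W x = i ∧ (W x * i + q) % W x = q := by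
    rw [Nat.mul_add_div (hW0 x), Nat.div_eq_of_lt hq, Nat.mul_add_mod_self_left,
      Nat.mod_eq_of_lt hq]
    exact ⟨rfl, rfl⟩
  have hE_high : ∀ i < 2 ^ W x, ∀ q < W x, D x + L x ≤ q →
      (E inp x).testBit (W x * i + q) = false := by
    intro i _ q hq hq'
    rw [hE, hnone, (hdm hq).1, (hdm hq).2]
    simp
    omega
  have hE_low {i q : ℕ} (hi : i < 2 ^ W x) (hq : q < D x + L x) :
      (E inp x).testBit (W x * i + q) = true ↔ ∃ p < L x, q = D x + p ∧
        ok (flags inp (2 ^ x) p) (fun d b =>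
          (2 ^ W x - 1 - i).testBit (b * S x + (p + offset (2 ^ x) d))) = false := by
    rw [hE, hnone, (hdm (hq.trans hDL)).1, (hdm (hq.trans hDL)).2]
    by_cases hqD : D x ≤ q
    · obtain ⟨p, rfl⟩ := Nat.exists_eq_add_of_le hqD
      have hp : p < L x := by omega
      simp only [hflag hi hp, hplane hi hp]
      simp [hi, hp]
    · simp only [hqD, decide_false, Bool.false_and, Bool.and_false, Bool.false_eq_true, false_iff]
      rintro ⟨p, -, rfl, -⟩
      omega
  have hmain := add_land_eq_iff hDL hE_lt hE_high
  have hcand : (∀ i < 2 ^ W x, ∃ q < D x + L x, (E inp x).testBit (W x * i + q) = true) ↔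
      ∀ u < 2 ^ W x, ∃ p < L x, ok (flags inp (2 ^ x) p) (fun d b =>
        u.testBit (b * S x + (p + offset (2 ^ x) d))) = false := by
    constructor
    · intro h u hu
      obtain ⟨q, hq, h⟩ := h (2 ^ W x - 1 - u) (by omega)
      obtain ⟨p, hp, -, h⟩ := (hE_low (by omega) hq).1 h
      rw [show 2 ^ W x - 1 - (2 ^ W x - 1 - u) = u by omega] at h
      exact ⟨p, hp, h⟩
    · intro h i hi
      obtain ⟨p, hp, h⟩ := h (2 ^ W x - 1 - i) (by omega)
      exact ⟨D x + p, by omega, (hE_low hi (by omega)).2 ⟨p, hp, rfl, h⟩⟩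
  rw [Ne, hmain.trans hcand, ← hLc]
  push Not
  constructor
  · rintro ⟨u, -, h⟩
    exact ⟨fun p b => u.testBit (b * S x + p), fun p hp => by simpa using h p hp⟩
  · rintro ⟨y, h⟩
    have hS : 0 < S x := by positivity
    refine ⟨Nat.ofBits fun q : Fin (W x) =>
      if hq : q / S x < B then y (q % S x) ⟨q / S x, hq⟩ else false, Nat.ofBits_lt_two_pow _,
      fun p hp => ?_⟩
    rw [Ne, Bool.not_eq_false, ← h p hp]
    congr 1
    funext d b
    have hlt : p + offset (2 ^ x) d < S x := by
      have h1 : 2 ^ x + 1 ≤ L x := by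
        have : 2 ^ x < L x := Nat.pow_lt_pow_right (by norm_num) (by omega)
        omega
      have h2 : offset (2 ^ x) d ≤ 2 ^ x + 1 := by fin_cases d <;> simp [offset]
      have h3 := hLS x
      omega
    have hqW : b * S x + (p + offset (2 ^ x) d) < W x := by
      have h1 := hSW x
      have h2 : ((b : ℕ) + 1) * S x ≤ (B + 3) * S x := Nat.mul_le_mul_right _ (by omega)
      rw [add_mul] at h2
      omega
    have hq1 : (b * S x + (p + offset (2 ^ x) d)) / S x = b := by
      rw [mul_comm, Nat.mul_add_div hS, Nat.div_eq_of_lt hlt, add_zero]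
    have hq2 : (b * S x + (p + offset (2 ^ x) d)) % S x = p + offset (2 ^ x) d := by
      rw [Nat.mul_add_mod_self_right, Nat.mod_eq_of_lt hlt]
    rw [Nat.testBit_ofBits_lt _ _ hqW]
    simp only [hq1, hq2, b.2, dif_pos]

/-! ### Recognizing recursively enumerable sets -/

/-- A finite nonempty type is a quotient of a type of bit vectors. -/
theorem exists_surjective_bits (A : Type*) [Finite A] [Nonempty A] :
    ∃ (B : ℕ) (dec : (Fin B → Bool) → A), Function.Surjective dec := by
  classical
  obtain ⟨B, ⟨e⟩⟩ := Finite.exists_equiv_fin A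
  have hinj : Function.Injective fun (a : A) (i : Fin B) => decide (e a = i) := by
    intro a a' h
    have := congrFun h (e a)
    simp only [decide_true] at this
    exact (e.injective (of_decide_eq_true this.symm)).symm
  exact ⟨B, _, Function.invFun_surjective hinj⟩

open Turing.PartrecToTM2 in
/-- The initial contents of the stacks at some depth in terms of the input-dependent `flags`. -/
def initEntries (bit digit marker : Bool) : K' → Option Γ'
  | .main => bif marker then some .cons else
      bif digit then some (bif bit then .bit1 else .bit0) else none
  | _ => none

open Turing.PartrecToTM2 in
theorem getElem?_elim_trList (n j : ℕ) (k : K') :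
    (K'.elim (trList [n]) [] [] [] k)[j]? =
      initEntries (n.testBit j) (decide (j < n.size)) (decide (j = n.size)) k := by
  cases k with
  | main =>
    rw [K'.elim, getElem?_trList_singleton]
    by_cases h₁ : j = n.size
    · simp [h₁, initEntries]
    · by_cases h₂ : j < n.size <;> simp [h₁, h₂, initEntries]
  | _ => rfl

open Turing.PartrecToTM2 in
/-- Membership in a recursively enumerable set is, for all large `x`, the inequality of two numbers
that straight-line code computes. -/
theorem exists_computed_recognizer {S : Set ℕ} (hS : REPred fun n => n ∈ S) :
    ∃ F G : ℕ → ℕ → ℕ, Computed F ∧ Computed G ∧ ∀ inp, ∃ x₀, ∀ x ≥ x₀,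
      (F inp x ≠ G inp x ↔ inp ∈ S) := by
  classical
  obtain ⟨Q, _, M, q₀, hM⟩ := exists_stackMachine hS
  have : Nonempty (Q × (K' → Option Γ')) := ⟨(q₀, fun _ => none)⟩
  obtain ⟨B, dec, hdec⟩ := exists_surjective_bits (Q × (K' → Option Γ'))
  obtain ⟨F, G, hF, hG, h⟩ := exists_computed_search B fun f w => decide
    (M.LocallyValid q₀ (initEntries (f 4) (f 5) (f 6)) (f 0) (f 1) (f 2) (f 3)
      (dec (w 0)) (dec (w 1)) (dec (w 2)) (dec (w 3)))
  refine ⟨F, G, hF, hG, fun inp => ?_⟩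
  obtain ⟨x₁, h⟩ := h inp
  let stk := K'.elim (trList [inp]) [] [] []
  have hdiag (x : ℕ) (y : ℕ → Fin B → Bool) : (∀ p < 2 ^ x * 2 ^ x, decide
      (M.LocallyValid q₀ (initEntries (flags inp (2 ^ x) p 4) (flags inp (2 ^ x) p 5)
        (flags inp (2 ^ x) p 6)) (flags inp (2 ^ x) p 0) (flags inp (2 ^ x) p 1)
        (flags inp (2 ^ x) p 2) (flags inp (2 ^ x) p 3) (dec (y (p + offset (2 ^ x) 0)))
        (dec (y (p + offset (2 ^ x) 1))) (dec (y (p + offset (2 ^ x) 2)))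
        (dec (y (p + offset (2 ^ x) 3)))) = true) ↔
      M.IsDiagram q₀ (fun p k => (stk k)[p]?) (2 ^ x) fun p => dec (y p) := by
    refine forall₂_congr fun p _ => ?_
    simp only [stk, getElem?_elim_trList, decide_eq_true_eq]
    simp [flags, offset, add_assoc]
  by_cases hinp : inp ∈ S
  · obtain ⟨c₀, hc₀⟩ := StackMachine.exists_isDiagram ((hM inp).1 hinp)
    refine ⟨max x₁ c₀, fun x hx => ?_⟩
    have hx₁ : x ≥ x₁ := le_trans (le_max_left _ _) hx
    have hx₀ : 2 ^ x ≥ c₀ := (le_trans (le_max_right _ _) hx).trans x.lt_two_pow_self.le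
    obtain ⟨s, hs⟩ := hc₀ _ hx₀
    refine iff_of_true ((h x hx₁).2 ⟨fun p => Function.surjInv hdec (s p), ?_⟩) hinp
    refine (hdiag x _).2 ?_
    simpa only [Function.surjInv_eq hdec] using hs
  · refine ⟨x₁, fun x hx => iff_of_false (fun hne => hinp ?_) hinp⟩
    obtain ⟨y, hy⟩ := (h x hx).1 hne
    exact (hM inp).2 (((hdiag x y).1 hy).halts (by positivity))

end ARAM

theorem theorem5 (S : Set ℕ) (hS : REPred fun inp : ℕ => inp ∈ S) :
    ∃ C : ℕ, ARAM.ARAMComputable ARAM.addDivShiftBool (fun _ => C) S := by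
  obtain ⟨F, G, hF, hG, h⟩ := ARAM.exists_computed_recognizer hS
  obtain ⟨C, hC⟩ := hF.ramComputable ARAM.opAdd_mem hG
  refine ⟨C, _, hC, fun inp => ?_⟩
  obtain ⟨x₀, hx₀⟩ := h inp
  rw [Nat.cofinite_eq_atTop]
  refine ⟨fun hinp => ?_, fun hinp => ?_⟩
  · filter_upwards [Filter.eventually_ge_atTop x₀] with x hx
    exact decide_eq_true ((hx₀ x hx).2 hinp)
  · filter_upwards [Filter.eventually_ge_atTop x₀] with x hx
    exact decide_eq_false fun hne => hinp ((hx₀ x hx).1 hne)
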